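/- Let $d\in\{2,3\}$ and let $\Omega\subset\mathbb R^d$ be a bounded, simply connected polyhedral domain with Lipschitz boundary. Let $\Gamma_D\subset\partial\Omega$. For $\Gamma\subset\partial\Omega$, $H^1_{0,\Gamma}(\Omega,\mathbb R^d)$ denotes the functions in $H^1(\Omega,\mathbb R^d)$ whose trace vanishes on $\Gamma$ (almost everywhere for the surface measure), and $\|v\|_{1,\Omega}$ is the standard $H^1$ norm. Then there is a constant $C>0$, depending only on $\Omega$ and $\Gamma_D$, for which the following holds. Let $\Gamma_N\subset\partial\Omega$ be such that $\partial\Omega=\overline{\Gamma_D\cup\Gamma_N}$, $\Gamma_D\cap\Gamma_N=\emptyset$, $|\Gamma_D|>0$ and $|\partial\Omega\setminus(\Gamma_D\cup\Gamma_N)|=0$ (surface measure). Let $\mathcal T_h$ be a finite partition of $\Omega$ into non-overlapping open convex polyhedra $K$ without hanging nodes (the closures of two distinct elements meet in a common, possibly empty, face). Set: - $\mathcal X=\{v\in L^2(\Omega,\mathbb R^d): v|_K\in H^1(K,\mathbb R^d)\ \forall K\in\mathcal T_h\}$, with $$\|v\|_{\mathcal X}^2=\sum_{K\in\mathcal T_h}\Big(\rho_\Omega^{-2}\|v\|_{0,K}^2+\|\varepsilon(v)\|_{0,K}^2\Big),$$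 where $\rho_\Omega=\operatorname{diam}\Omega$ and $\varepsilon(v)=\tfrac12(\nabla v+\nabla v^{t})$; - $H_{0,\Gamma_N}(\mathrm{div},\Omega,\mathbb S)$: the symmetric tensor fields $\tau\in L^2(\Omega,\mathbb R^{d\times d}_{\rm sym})$ with row-wise divergence in $L^2$ such that $\int_{\partial\Omega}(\tau n)\cdot v\,ds=0$ for all $v\in H^1_{0,\partial\Omega\setminus\Gamma_N}(\Omega,\mathbb R^d)$, boundary integrals being the $H^{-1/2}$–$H^{1/2}$ duality, $\int_{\partial D}(\tau n)\cdot v\,ds=\int_D(\operatorname{div}\tau\cdot v+\tau:\nabla v)\,dx$; - $\mathcal M$: the families $l=(l_K)_K\in\prod_{K}H^{-1/2}(\partial K,\mathbb R^d)$ for which there is $\tau\in H_{0,\Gamma_N}(\mathrm{div},\Omega,\mathbb S)$ with $\tau n^{\partial K}=l_K$ on $\partial K$ for all $K$; - $\mathcal P=L^2(\Omega)$, except that $\mathcal P=\{q\in L^2(\Omega):\int_\Omega q=0\}$ if $\Gamma_D=\partial\Omega$; - $b(v,l)=-\sum_K\langle l_K,v\rangle_{\partial K}$ for $v\in\mathcal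 X$, $l\in\mathcal M$, and $c(v,q)=\sum_K\int_K(\operatorname{div}v)\,q\,dx$ for $v\in\mathcal X$, $q\in\mathcal P$. Then: 1. $\|v\|_{\mathcal X}\le C\|v\|_{1,\Omega}$ for all $v\in H^1_{0,\Gamma_D}(\Omega,\mathbb R^d)$. 2. Let $\mathcal U_h\subset H^1_{0,\Gamma_D}(\Omega,\mathbb R^d)$, $\mathcal P_h\subset\mathcal P$, $\mathcal M_h\subset\mathcal M$ be finite-dimensional subspaces, and suppose that $\mathcal U_h\times\mathcal P_h$ is inf-sup stable for the Stokes problem: for some $\beta_S>0$, $$\sup_{v\in\mathcal U_h,\,v\ne0}\frac{c(v,q)}{\|v\|_{1,\Omega}}\ \ge\ \beta_S\|q\|_{0,\Omega}\qquad\forall q\in\mathcal P_h .$$ Then for every finite-dimensional subspace $\mathcal X_h\subset\mathcal X$ with $\mathcal U_h\subset\mathcal X_h$, the kernel $\mathcal N_h^b=\{v\in\mathcal X_h: b(v,l)=0\ \forall l\in\mathcal M_h\}$ satisfies $$\sup_{v\in\mathcal N_h^b,\,v\ne0}\frac{c(v,z)}{\|v\|_{\mathcal X}}\ \ge\ \tilde\beta\,\|z\|_{0,\Omega}\qquad\forall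 z\in\mathcal P_h,\qquad \tilde\beta=\frac{\beta_S}{C}>0 .$$ -/

import Mathlib

open MeasureTheory Set Filter Topology
open scoped ENNReal ContDiff

noncomputable section

namespace HDP

/-- The Euclidean space of dimension `d`. -/
abbrev E (d : ℕ) := EuclideanSpace ℝ (Fin d)

/-- The surface measure: the Hausdorff measure of dimension `d - 1` (up to a positive constant
factor, which plays no role below: only null sets and square-integrability are used). -/
def surf (d : ℕ) : Measure (E d) := Measure.hausdorffMeasure ((d : ℝ) - 1)

/-! ### Sobolev spaces -/

/-- The partial derivative in direction `j` of a function of class C^1. -/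
def pderiv {d : ℕ} (j : Fin d) (φ : E d → ℝ) (x : E d) : ℝ :=
  fderiv ℝ φ x (EuclideanSpace.single j 1)

/-- `φ` is a scalar test function on `D`, that is, `φ ∈ C_c^∞(D)`. -/
def IsTest {d : ℕ} (D : Set (E d)) (φ : E d → ℝ) : Prop :=
  ContDiff ℝ ∞ φ ∧ HasCompactSupport φ ∧ tsupport φ ⊆ D

/-- `g ∈ L²(D)` is the weak partial derivative of `f` in direction `j` on `D`. -/
def HasWeakPartial {d : ℕ} (D : Set (E d)) (j : Fin d) (f g : E d → ℝ) : Prop :=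
  MemLp g 2 (volume.restrict D) ∧
    ∀ φ, IsTest D φ → ∫ x in D, f x * pderiv j φ x = - ∫ x in D, g x * φ x

open Classical in
/-- The weak partial derivative in `L²(D)` (unique almost everywhere on an open `D`). -/
def weakPartial {d : ℕ} (D : Set (E d)) (j : Fin d) (f : E d → ℝ) : E d → ℝ :=
  if h : ∃ g, HasWeakPartial D j f g then h.choose else 0

/-- The weak gradient on `D`: the entry `(i, j)` is the derivative of the component `i` in
direction `j`. -/
def wgrad {d : ℕ} (D : Set (E d)) (v : E d → E d) (x : E d) : Matrix (Fin d) (Fin d) ℝ :=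
  Matrix.of fun i j => weakPartial D j (fun y => v y i) x

/-- The weak divergence on `D`. -/
def wdiv {d : ℕ} (D : Set (E d)) (v : E d → E d) (x : E d) : ℝ := (wgrad D v x).trace

/-- The strain tensor on `D`: the symmetric part of the gradient. -/
def strain {d : ℕ} (D : Set (E d)) (v : E d → E d) (x : E d) : Matrix (Fin d) (Fin d) ℝ :=
  (1 / 2 : ℝ) • (wgrad D v x + (wgrad D v x).transpose)

/-- The Frobenius product of two matrices. -/
def frob {d : ℕ} (A B : Matrix (Fin d) (Fin d) ℝ) : ℝ := ∑ i, ∑ j, A i j * B i j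

lemma IsTest.memLp_pderiv {d : ℕ} {D : Set (E d)} {φ : E d → ℝ} (h : IsTest D φ) (j : Fin d) :
    MemLp (pderiv j φ) 2 (volume.restrict D) := by
  have hc : Continuous (pderiv j φ) :=
    (h.1.continuous_fderiv (by simp)).clm_apply continuous_const
  have hs : HasCompactSupport (pderiv j φ) :=
    (h.2.1.fderiv (𝕜 := ℝ)).comp_left (g := fun L : E d →L[ℝ] ℝ => L (EuclideanSpace.single j 1))
      (by simp)
  exact (hc.memLp_of_hasCompactSupport hs).restrict D

lemma IsTest.memLp {d : ℕ} {D : Set (E d)} {φ : E d → ℝ} (h : IsTest D φ) :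
    MemLp φ 2 (volume.restrict D) :=
  (h.1.continuous.memLp_of_hasCompactSupport h.2.1).restrict D

lemma HasWeakPartial.add {d : ℕ} {D : Set (E d)} {j : Fin d} {f f' g g' : E d → ℝ}
    (hf : MemLp f 2 (volume.restrict D)) (hf' : MemLp f' 2 (volume.restrict D))
    (h : HasWeakPartial D j f g) (h' : HasWeakPartial D j f' g') :
    HasWeakPartial D j (fun x => f x + f' x) (fun x => g x + g' x) := by
  refine ⟨h.1.add h'.1, fun φ hφ => ?_⟩
  have h1 : Integrable (fun x => f x * pderiv j φ x) (volume.restrict D) :=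
    hf.integrable_mul (hφ.memLp_pderiv j)
  have h2 : Integrable (fun x => f' x * pderiv j φ x) (volume.restrict D) :=
    hf'.integrable_mul (hφ.memLp_pderiv j)
  have h3 : Integrable (fun x => g x * φ x) (volume.restrict D) := h.1.integrable_mul hφ.memLp
  have h4 : Integrable (fun x => g' x * φ x) (volume.restrict D) := h'.1.integrable_mul hφ.memLp
  simp only [add_mul]
  rw [integral_add h1 h2, integral_add h3 h4, h.2 φ hφ, h'.2 φ hφ]
  ring

lemma HasWeakPartial.smul {d : ℕ} {D : Set (E d)} {j : Fin d} {f g : E d → ℝ} (a : ℝ)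
    (h : HasWeakPartial D j f g) :
    HasWeakPartial D j (fun x => a * f x) (fun x => a * g x) := by
  refine ⟨h.1.const_mul a, fun φ hφ => ?_⟩
  simp only [mul_assoc]
  rw [integral_const_mul, integral_const_mul, h.2 φ hφ]
  ring

lemma HasWeakPartial.zero {d : ℕ} {D : Set (E d)} {j : Fin d} :
    HasWeakPartial D j (fun _ => 0) (fun _ => 0) :=
  ⟨MemLp.zero', fun φ _ => by simp⟩

lemma memLp_coord {d : ℕ} {μ : Measure (E d)} {v : E d → E d} (h : MemLp v 2 μ) (i : Fin d) :
    MemLp (fun x => v x i) 2 μ :=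
  (EuclideanSpace.proj i : E d →L[ℝ] ℝ).comp_memLp' h

/-- The space `H¹(D, ℝ^d)` (of functions, not yet identified almost everywhere). -/
def H1 {d : ℕ} (D : Set (E d)) : Submodule ℝ (E d → E d) where
  carrier := {v | MemLp v 2 (volume.restrict D) ∧
    ∀ i j, ∃ g, HasWeakPartial D j (fun x => v x i) g}
  add_mem' := by
    rintro v w ⟨hv, hv'⟩ ⟨hw, hw'⟩
    refine ⟨hv.add hw, fun i j => ?_⟩
    obtain ⟨g, hg⟩ := hv' i j
    obtain ⟨k, hk⟩ := hw' i j
    exact ⟨_, hg.add (memLp_coord hv i) (memLp_coord hw i) hk⟩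
  zero_mem' := ⟨MemLp.zero, fun _ _ => ⟨_, HasWeakPartial.zero⟩⟩
  smul_mem' := by
    rintro a v ⟨hv, hv'⟩
    refine ⟨hv.const_smul a, fun i j => ?_⟩
    obtain ⟨g, hg⟩ := hv' i j
    exact ⟨_, hg.smul a⟩

/-- The square of the `L²(D)` norm of a vector field. -/
def l2sq {d : ℕ} (D : Set (E d)) (v : E d → E d) : ℝ := ∫ x in D, ‖v x‖ ^ 2

/-- The square of the `L²(D)` norm of a tensor field. -/
def l2sqT {d : ℕ} (D : Set (E d)) (A : E d → Matrix (Fin d) (Fin d) ℝ) : ℝ :=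
  ∫ x in D, frob (A x) (A x)

/-- The norm of `H¹(D, ℝ^d)`. -/
def h1norm {d : ℕ} (D : Set (E d)) (v : E d → E d) : ℝ :=
  Real.sqrt (l2sq D v + l2sqT D (wgrad D v))

/-! ### Traces -/

/-- `g ∈ L²(∂D, ℝ^d)` is the trace of `v ∈ H¹(D, ℝ^d)`: some sequence of smooth functions
converges to `v` in `H¹(D)`, while its restrictions to `∂D` converge to `g` in `L²(∂D)`. On a
bounded Lipschitz domain this is the graph of the usual trace operator. -/
def HasTrace {d : ℕ} (D : Set (E d)) (v g : E d → E d) : Prop :=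
  MemLp v 2 (volume.restrict D) ∧ MemLp g 2 ((surf d).restrict (frontier D)) ∧
  ∃ (G : Fin d → Fin d → E d → ℝ) (φ : ℕ → E d → E d),
    (∀ i j, HasWeakPartial D j (fun x => v x i) (G i j)) ∧
    (∀ n, ContDiff ℝ ∞ (φ n)) ∧
    Tendsto (fun n => eLpNorm (φ n - v) 2 (volume.restrict D)) atTop (𝓝 0) ∧
    (∀ i j, Tendsto (fun n => eLpNorm (pderiv j (fun x => φ n x i) - G i j) 2
      (volume.restrict D)) atTop (𝓝 0)) ∧
    Tendsto (fun n => eLpNorm (φ n - g) 2 ((surf d).restrict (frontier D))) atTop (𝓝 0)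

lemma tendsto_eLpNorm_add {d : ℕ} {F : Type*} [NormedAddCommGroup F] {μ : Measure (E d)}
    {a b : ℕ → E d → F} (ha : ∀ n, AEStronglyMeasurable (a n) μ)
    (hb : ∀ n, AEStronglyMeasurable (b n) μ)
    (h1 : Tendsto (fun n => eLpNorm (a n) 2 μ) atTop (𝓝 0))
    (h2 : Tendsto (fun n => eLpNorm (b n) 2 μ) atTop (𝓝 0)) :
    Tendsto (fun n => eLpNorm (a n + b n) 2 μ) atTop (𝓝 0) := by
  have h := h1.add h2
  rw [add_zero] at h
  exact tendsto_of_tendsto_of_tendsto_of_le_of_le tendsto_const_nhds h (fun _ => zero_le)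
    (fun n => eLpNorm_add_le (ha n) (hb n) (by norm_num))

lemma tendsto_eLpNorm_smul {d : ℕ} {F : Type*} [NormedAddCommGroup F] [NormedSpace ℝ F]
    {μ : Measure (E d)} {a : ℕ → E d → F} (c : ℝ)
    (h1 : Tendsto (fun n => eLpNorm (a n) 2 μ) atTop (𝓝 0)) :
    Tendsto (fun n => eLpNorm (c • a n) 2 μ) atTop (𝓝 0) := by
  simp only [eLpNorm_const_smul]
  have h := ENNReal.Tendsto.const_mul (a := ‖c‖ₑ) h1 (Or.inr enorm_ne_top)
  rwa [mul_zero] at h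

lemma contDiff_coord {d : ℕ} {φ : E d → E d} (h : ContDiff ℝ ∞ φ) (i : Fin d) :
    ContDiff ℝ ∞ (fun x => φ x i) :=
  (EuclideanSpace.proj i : E d →L[ℝ] ℝ).contDiff.comp h

lemma continuous_pderiv {d : ℕ} {φ : E d → ℝ} (h : ContDiff ℝ ∞ φ) (j : Fin d) :
    Continuous (pderiv j φ) :=
  (h.continuous_fderiv (by simp)).clm_apply continuous_const

lemma HasTrace.add {d : ℕ} {D : Set (E d)} {v w g k : E d → E d}
    (h : HasTrace D v g) (h' : HasTrace D w k) : HasTrace D (v + w) (g + k) := by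
  obtain ⟨hv, hg, G, φ, h1, h2, h3, h4, h5⟩ := h
  obtain ⟨hw, hk, G', φ', h1', h2', h3', h4', h5'⟩ := h'
  refine ⟨hv.add hw, hg.add hk, fun i j x => G i j x + G' i j x, fun n => φ n + φ' n,
    fun i j => (h1 i j).add (memLp_coord hv i) (memLp_coord hw i) (h1' i j),
    fun n => (h2 n).add (h2' n), ?_, fun i j => ?_, ?_⟩
  · simp only [add_sub_add_comm]
    exact tendsto_eLpNorm_add
      (fun n => (h2 n).continuous.aestronglyMeasurable.sub hv.1)
      (fun n => (h2' n).continuous.aestronglyMeasurable.sub hw.1) h3 h3'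
  · have he : ∀ n, pderiv j (fun x => (φ n + φ' n) x i) - (fun x => G i j x + G' i j x)
        = (pderiv j (fun x => φ n x i) - G i j) + (pderiv j (fun x => φ' n x i) - G' i j) := by
      intro n
      ext x
      have e1 := ((contDiff_coord (h2 n) i).differentiable (by simp)) x
      have e2 := ((contDiff_coord (h2' n) i).differentiable (by simp)) x
      have e3 := fderiv_fun_add e1 e2
      simp only [pderiv, Pi.sub_apply, Pi.add_apply, PiLp.add_apply]
      rw [e3]
      simp only [_root_.add_apply]
      ring
    simp only [he]
    exact tendsto_eLpNorm_add
      (fun n => (continuous_pderiv (contDiff_coord (h2 n) i) j).aestronglyMeasurable.sub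
        (h1 i j).1.1)
      (fun n => (continuous_pderiv (contDiff_coord (h2' n) i) j).aestronglyMeasurable.sub
        (h1' i j).1.1) (h4 i j) (h4' i j)
  · simp only [add_sub_add_comm]
    exact tendsto_eLpNorm_add
      (fun n => (h2 n).continuous.aestronglyMeasurable.sub hg.1)
      (fun n => (h2' n).continuous.aestronglyMeasurable.sub hk.1) h5 h5'

lemma HasTrace.smul {d : ℕ} {D : Set (E d)} {v g : E d → E d} (c : ℝ)
    (h : HasTrace D v g) : HasTrace D (c • v) (c • g) := by
  obtain ⟨hv, hg, G, φ, h1, h2, h3, h4, h5⟩ := h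
  refine ⟨hv.const_smul c, hg.const_smul c, fun i j x => c * G i j x, fun n => c • φ n,
    fun i j => (h1 i j).smul c, fun n => (h2 n).const_smul c, ?_, fun i j => ?_, ?_⟩
  · simp only [← smul_sub]
    exact tendsto_eLpNorm_smul c h3
  · have he : ∀ n, pderiv j (fun x => (c • φ n) x i) - (fun x => c * G i j x)
        = c • (pderiv j (fun x => φ n x i) - G i j) := by
      intro n
      ext x
      have e1 := ((contDiff_coord (h2 n) i).differentiable (by simp)) x
      have e3 := fderiv_fun_const_smul e1 c
      simp only [smul_eq_mul] at e3
      simp only [pderiv, Pi.sub_apply, Pi.smul_apply, PiLp.smul_apply, smul_eq_mul]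
      rw [e3]
      simp only [_root_.smul_apply, smul_eq_mul]
      ring
    simp only [he]
    exact tendsto_eLpNorm_smul c (h4 i j)
  · simp only [← smul_sub]
    exact tendsto_eLpNorm_smul c h5

lemma HasTrace.zero {d : ℕ} {D : Set (E d)} : HasTrace D 0 0 := by
  refine ⟨MemLp.zero, MemLp.zero, fun _ _ _ => 0, fun _ => 0, fun _ _ => HasWeakPartial.zero,
    fun _ => contDiff_const, ?_, fun i j => ?_, ?_⟩
  · simp
  · have : pderiv j (fun x : E d => (0 : E d → E d) x i) - (fun _ => 0) = 0 := by
      ext x; simp [pderiv]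
    simp only [this]
    simp
  · simp

/-- The space of the functions of `H¹(D, ℝ^d)` whose trace vanishes on `Γ ⊆ ∂D`. -/
def H10 {d : ℕ} (D Γ : Set (E d)) : Submodule ℝ (E d → E d) where
  carrier := {v | ∃ g, HasTrace D v g ∧
    ∀ᵐ x ∂((surf d).restrict (frontier D)), x ∈ Γ → g x = 0}
  add_mem' := by
    rintro v w ⟨g, hg, hg'⟩ ⟨k, hk, hk'⟩
    refine ⟨g + k, hg.add hk, ?_⟩
    filter_upwards [hg', hk'] with x h1 h2 hx
    simp [h1 hx, h2 hx]
  zero_mem' := ⟨0, HasTrace.zero, by simp⟩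
  smul_mem' := by
    rintro c v ⟨g, hg, hg'⟩
    refine ⟨c • g, hg.smul c, ?_⟩
    filter_upwards [hg'] with x h1 hx
    simp [h1 hx]

/-- The trace space `H^{1/2}(∂D, ℝ^d)`: the image of the trace operator, realised as `H¹(D, ℝ^d)`
modulo the functions with zero trace on `∂D`. -/
abbrev HHalf {d : ℕ} (D : Set (E d)) : Type :=
  H1 D ⧸ (H10 D (frontier D)).submoduleOf (H1 D)

/-- The dual space `H^{-1/2}(∂D, ℝ^d)`: the linear functionals on `H^{1/2}(∂D, ℝ^d)` that are
bounded for the quotient norm. -/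
def HMinusHalf {d : ℕ} (D : Set (E d)) : Submodule ℝ (Module.Dual ℝ (HHalf D)) where
  carrier := {l | ∃ C : ℝ, ∀ v : H1 D, |l (Submodule.Quotient.mk v)| ≤ C * h1norm D v}
  add_mem' := by
    rintro l m ⟨C, hC⟩ ⟨B, hB⟩
    refine ⟨C + B, fun v => ?_⟩
    rw [LinearMap.add_apply, add_mul]
    exact (abs_add_le _ _).trans (add_le_add (hC v) (hB v))
  zero_mem' := ⟨0, fun v => by simp⟩
  smul_mem' := by
    rintro c l ⟨C, hC⟩
    refine ⟨|c| * C, fun v => ?_⟩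
    rw [LinearMap.smul_apply, smul_eq_mul, abs_mul, mul_assoc]
    exact mul_le_mul_of_nonneg_left (hC v) (abs_nonneg c)

open Classical in
/-- The trace on `∂D`, as an element of `H^{1/2}(∂D, ℝ^d)`, of a function whose restriction to `D`
is in `H¹(D, ℝ^d)`. -/
def traceOn {d : ℕ} (D : Set (E d)) (v : E d → E d) : HHalf D :=
  if h : v ∈ H1 D then Submodule.Quotient.mk ⟨v, h⟩ else 0

/-! ### The space `H(div)` of symmetric tensors -/

/-- `τ ∈ H(div, D, 𝕊)`, and `f` is the row-wise divergence of `τ`. -/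
structure HasDivSym {d : ℕ} (D : Set (E d)) (τ : E d → Matrix (Fin d) (Fin d) ℝ)
    (f : E d → E d) : Prop where
  memLp : ∀ i j, MemLp (fun x => τ x i j) 2 (volume.restrict D)
  symm : ∀ᵐ x ∂(volume.restrict D), (τ x).IsSymm
  memLp_div : MemLp f 2 (volume.restrict D)
  div_eq : ∀ φ, IsTest D φ → ∀ i,
    ∫ x in D, ∑ j, τ x i j * pderiv j φ x = - ∫ x in D, f x i * φ x

/-- The duality product of the normal trace `τ n` on `∂D` with the trace of `v`, where `f` is the
divergence of `τ`. -/
def normalPairing {d : ℕ} (D : Set (E d)) (τ : E d → Matrix (Fin d) (Fin d) ℝ)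
    (f v : E d → E d) : ℝ :=
  (∫ x in D, inner ℝ (f x) (v x)) + ∫ x in D, frob (τ x) (wgrad D v x)

/-- `τ ∈ H_{0,Γ}(div, D, 𝕊)`, and `f` is the divergence of `τ`. -/
def HasDivSymZero {d : ℕ} (D Γ : Set (E d)) (τ : E d → Matrix (Fin d) (Fin d) ℝ)
    (f : E d → E d) : Prop :=
  HasDivSym D τ f ∧ ∀ v ∈ H10 D (frontier D \ Γ), normalPairing D τ f v = 0

/-! ### Domains, boundary parts, meshes -/

/-- Near each boundary point, in suitable Cartesian coordinates, `D` is the region below the graph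
of a Lipschitz function (`e` is the vertical direction, and `γ` does not depend on the vertical
coordinate). -/
def HasLipschitzBoundary {d : ℕ} (D : Set (E d)) : Prop :=
  ∀ x ∈ frontier D, ∃ (e : E d) (ε : ℝ) (L : NNReal) (γ : E d → ℝ),
    ‖e‖ = 1 ∧ 0 < ε ∧ LipschitzWith L γ ∧ (∀ y (t : ℝ), γ (y + t • e) = γ y) ∧
    ∀ y ∈ Metric.ball x ε, y ∈ D ↔ inner ℝ e y < γ y

/-- Bounded, simply connected polyhedral domains with Lipschitz boundary. -/
structure IsPolyhedralDomain {d : ℕ} (Ω : Set (E d)) : Prop where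
  isOpen : IsOpen Ω
  bounded : Bornology.IsBounded Ω
  simplyConnected : SimplyConnectedSpace Ω
  polyhedral : ∃ S : Finset (Finset (E d)),
    closure Ω = ⋃ s ∈ S, convexHull ℝ (s : Set (E d))
  lipschitz : HasLipschitzBoundary Ω

/-- The boundary of `Ω` is partitioned into `ΓD` and `ΓN`, up to a set of surface measure zero,
and `ΓD` has positive surface measure. -/
structure IsBoundaryPartition {d : ℕ} (Ω ΓD ΓN : Set (E d)) : Prop where
  closure_eq : frontier Ω = closure (ΓD ∪ ΓN)
  disjoint : Disjoint ΓD ΓN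
  null : surf d (frontier Ω \ (ΓD ∪ ΓN)) = 0
  pos : 0 < surf d ΓD

/-- `𝒯` is a partition of `Ω` into non-overlapping open convex polyhedra without hanging nodes: the
closures of two different elements meet in a (possibly empty) face of both. -/
structure IsMesh {d : ℕ} (Ω : Set (E d)) (𝒯 : Finset (Set (E d))) : Prop where
  polytope : ∀ K ∈ 𝒯, K.Nonempty ∧
    ∃ s : Finset (E d), K = interior (convexHull ℝ (s : Set (E d)))
  subset : ∀ K ∈ 𝒯, K ⊆ Ω
  cover : closure Ω = ⋃ K ∈ 𝒯, closure K
  disjoint : ∀ K ∈ 𝒯, ∀ K' ∈ 𝒯, K ≠ K' → Disjoint K K'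
  conforming : ∀ K ∈ 𝒯, ∀ K' ∈ 𝒯, K ≠ K' → IsExposed ℝ (closure K) (closure K ∩ closure K')

/-! ### The spaces and the forms of the hybrid method -/

/-- `L²(Ω, ℝ^d)`. -/
abbrev L2V {d : ℕ} (Ω : Set (E d)) := Lp (E d) 2 (volume.restrict Ω)

/-- `L²(Ω, ℝ)`. -/
abbrev L2S {d : ℕ} (Ω : Set (E d)) := Lp ℝ 2 (volume.restrict Ω)

/-- `H¹_{0,Γ}(Ω, ℝ^d)` as a subset of `L²(Ω, ℝ^d)`. -/
def H10Space {d : ℕ} (Ω Γ : Set (E d)) : Set (L2V Ω) := {v | ⇑v ∈ H10 Ω Γ}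

/-- The broken space `𝒳`. -/
def XSpace {d : ℕ} (Ω : Set (E d)) (𝒯 : Finset (Set (E d))) : Set (L2V Ω) :=
  {v | ∀ K ∈ 𝒯, ⇑v ∈ H1 K}

/-- The norm of `𝒳`. -/
def xnorm {d : ℕ} {Ω : Set (E d)} (𝒯 : Finset (Set (E d))) (v : L2V Ω) : ℝ :=
  Real.sqrt (∑ K ∈ 𝒯, (1 / Metric.diam Ω ^ 2 * l2sq K v + l2sqT K (strain K v)))

/-- The product of the spaces `H^{-1/2}(∂K, ℝ^d)` over the elements `K`. -/
abbrev BoundaryFunctionals {d : ℕ} (𝒯 : Finset (Set (E d))) : Type :=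
  (K : 𝒯) → HMinusHalf (K : Set (E d))

/-- The multiplier space `ℳ`: the families `(l_K)` for which some `τ ∈ H_{0,ΓN}(div, Ω, 𝕊)`
satisfies `τ n = l_K` on `∂K` for every element `K`. -/
def MSpace {d : ℕ} (Ω ΓN : Set (E d)) (𝒯 : Finset (Set (E d))) : Set (BoundaryFunctionals 𝒯) :=
  {l | ∃ τ f, HasDivSymZero Ω ΓN τ f ∧ ∀ (K : 𝒯) (v : H1 (K : Set (E d))),
    (l K : Module.Dual ℝ (HHalf (K : Set (E d)))) (Submodule.Quotient.mk v) =
      normalPairing (K : Set (E d)) τ f v}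

/-- The pressure space `𝒫`: all of `L²(Ω)`, but only the functions of mean zero if `ΓD = ∂Ω`. -/
def PSpace {d : ℕ} (Ω ΓD : Set (E d)) : Set (L2S Ω) :=
  {q | ΓD = frontier Ω → ∫ x in Ω, q x = 0}

/-- The form `b(v, l) = - ∑_K ⟨l_K, v⟩_{∂K}`, for `v ∈ 𝒳`. -/
def bForm {d : ℕ} {Ω : Set (E d)} (𝒯 : Finset (Set (E d))) (v : L2V Ω)
    (l : BoundaryFunctionals 𝒯) : ℝ :=
  - ∑ K : 𝒯, (l K : Module.Dual ℝ (HHalf (K : Set (E d)))) (traceOn (K : Set (E d)) v)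

/-- The form `c(v, q) = ∑_K ∫_K (div v) q`, for `v ∈ 𝒳`. -/
def cForm {d : ℕ} {Ω : Set (E d)} (𝒯 : Finset (Set (E d))) (v : L2V Ω) (q : L2S Ω) : ℝ :=
  ∑ K ∈ 𝒯, ∫ x in K, wdiv K v x * q x

/-- The discrete kernel of `b`. -/
def kernelB {d : ℕ} {Ω : Set (E d)} (𝒯 : Finset (Set (E d))) (Xh : Submodule ℝ (L2V Ω))
    (Mh : Submodule ℝ (BoundaryFunctionals 𝒯)) : Set (L2V Ω) :=
  {v | v ∈ Xh ∧ ∀ l ∈ Mh, bForm 𝒯 v l = 0}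

/-- The inf-sup condition of `c` with constant `β` over `V × Q`, for the norm `nrm` on `V`:
`sup_{v ∈ V, v ≠ 0} c(v, q) / nrm v ≥ β ‖q‖` for all `q ∈ Q`. The supremum is taken in the
extended reals. -/
def InfSup {d : ℕ} {Ω : Set (E d)} (𝒯 : Finset (Set (E d))) (V : Set (L2V Ω))
    (Q : Set (L2S Ω)) (nrm : L2V Ω → ℝ) (β : ℝ) : Prop :=
  ∀ q ∈ Q, ((β * ‖q‖ : ℝ) : EReal) ≤
    ⨆ v ∈ {v : L2V Ω | v ∈ V ∧ v ≠ 0}, ((cForm 𝒯 v q / nrm v : ℝ) : EReal)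

end HDP

end

/-!
The constant is `C = 1 + 1 / diam Ω`.

*The broken norm is controlled by the `H¹` norm.* A weak derivative on `Ω` restricts to the weak
derivative on each element, by uniqueness of weak derivatives (`HasWeakPartial.ae_unique`,
`wgrad_ae_eq`). The elements are convex, so their frontiers are null sets and integrals over `Ω`
split into sums over the elements (`IsMesh.integral_eq_sum`). As `|ε(v)| ≤ |∇v|` pointwise in the
Frobenius norm, `‖v‖_𝒳² ≤ diam(Ω)⁻² ‖v‖₀² + ‖∇v‖₀²` (`xnorm_le`).

*Conforming fields lie in the kernel of `b`.* For `v ∈ H¹_{0,ΓD}(Ω)` and a multiplier `l` given by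
the normal traces of `τ`, the element pairings add up to the pairing of `τ n` with `v` on `∂Ω`,
which vanishes: `∂Ω \ ΓN` is contained in `ΓD` up to a null set, so `v` is an admissible test
function for the boundary condition of `τ` (`bForm_eq_zero`).

*Transfer of the inf-sup condition.* Hence `U_h` is contained in the kernel of `b` in `X_h`, and
the Stokes inf-sup condition on `U_h` passes to the kernel, with the loss of the factor `C` in the
change of norm. The norm `‖v‖_𝒳` of a nonzero `v` is positive because of its `L²` part
(`xnorm_pos`), so the quotients on the kernel side are meaningful.
-/

namespace HDP

/-! ### Weak derivatives and restriction to subdomains -/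

lemma weakPartial_spec {d : ℕ} {D : Set (E d)} {j : Fin d} {f : E d → ℝ}
    (h : ∃ g, HasWeakPartial D j f g) : HasWeakPartial D j f (weakPartial D j f) := by
  rw [weakPartial, dif_pos h]
  exact h.choose_spec

lemma HasWeakPartial.ae_unique {d : ℕ} {D : Set (E d)} (hD : IsOpen D) {j : Fin d}
    {f g g' : E d → ℝ} (h : HasWeakPartial D j f g) (h' : HasWeakPartial D j f g') :
    g =ᵐ[volume.restrict D] g' := by
  have hL : LocallyIntegrableOn (g - g') D volume := by
    rw [locallyIntegrableOn_iff hD.isLocallyClosed]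
    intro k hk hkc
    have h1 : MemLp (g - g') 2 (volume.restrict k) :=
      (h.1.sub h'.1).mono_measure (Measure.restrict_mono hk le_rfl)
    have : IsFiniteMeasure ((volume : Measure (E d)).restrict k) :=
      ⟨by simpa using hkc.measure_lt_top⟩
    exact h1.integrable (by norm_num)
  have key := hD.ae_eq_zero_of_integral_contDiff_smul_eq_zero hL fun φ h1 h2 h3 => by
    have hφ : IsTest D φ := ⟨h1, h2, h3⟩
    rw [← setIntegral_eq_integral_of_forall_compl_eq_zero (s := D) fun x hx => by
      rw [image_eq_zero_of_notMem_tsupport fun hx' => hx (h3 hx'), zero_smul]]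
    have e := (h.2 φ hφ).symm.trans (h'.2 φ hφ)
    have i1 : Integrable (fun x => g x * φ x) (volume.restrict D) := h.1.integrable_mul hφ.memLp
    have i2 : Integrable (fun x => g' x * φ x) (volume.restrict D) := h'.1.integrable_mul hφ.memLp
    calc ∫ x in D, φ x • (g - g') x = ∫ x in D, (g x * φ x - g' x * φ x) := by
          congr 1; ext x; simp only [Pi.sub_apply, smul_eq_mul]; ring
      _ = 0 := by rw [integral_sub i1 i2]; linarith
  filter_upwards [(ae_restrict_iff' hD.measurableSet).2 key] with x hx
  exact sub_eq_zero.1 hx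

lemma HasWeakPartial.mono {d : ℕ} {D K : Set (E d)} (hKD : K ⊆ D) {j : Fin d} {f g : E d → ℝ}
    (h : HasWeakPartial D j f g) : HasWeakPartial K j f g := by
  refine ⟨h.1.mono_measure (Measure.restrict_mono hKD le_rfl), fun φ hφ => ?_⟩
  have hz : ∀ x ∉ K, φ x = 0 := fun x hx =>
    image_eq_zero_of_notMem_tsupport fun hx' => hx (hφ.2.2 hx')
  have hz' : ∀ x ∉ K, pderiv j φ x = 0 := fun x hx => by
    have : fderiv ℝ φ x = 0 := by
      by_contra h0
      exact hx (hφ.2.2 (support_fderiv_subset ℝ h0))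
    simp [pderiv, this]
  have hI : ∀ u : E d → ℝ, (∀ x ∉ K, u x = 0) → ∫ x in K, u x = ∫ x in D, u x := fun u hu =>
    (setIntegral_eq_integral_of_forall_compl_eq_zero hu).trans
      (setIntegral_eq_integral_of_forall_compl_eq_zero fun x hx => hu x fun hx' => hx (hKD hx')).symm
  rw [hI _ fun x hx => by rw [hz' x hx, mul_zero], hI _ fun x hx => by rw [hz x hx, mul_zero]]
  exact h.2 φ ⟨hφ.1, hφ.2.1, hφ.2.2.trans hKD⟩

lemma H1_mono {d : ℕ} {D K : Set (E d)} (hKD : K ⊆ D) {v : E d → E d} (hv : v ∈ H1 D) :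
    v ∈ H1 K :=
  ⟨hv.1.mono_measure (Measure.restrict_mono hKD le_rfl), fun i j =>
    (hv.2 i j).imp fun _ hg => hg.mono hKD⟩

lemma H10_le_H1 {d : ℕ} (D Γ : Set (E d)) : H10 D Γ ≤ H1 D := by
  rintro v ⟨g, ⟨hv, -, G, φ, hG, -⟩, -⟩
  exact ⟨hv, fun i j => ⟨_, hG i j⟩⟩

lemma memLp_wgrad {d : ℕ} {D : Set (E d)} {v : E d → E d} (hv : v ∈ H1 D) (i j : Fin d) :
    MemLp (fun x => wgrad D v x i j) 2 (volume.restrict D) :=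
  (weakPartial_spec (hv.2 i j)).1

lemma wgrad_ae_eq {d : ℕ} {D K : Set (E d)} (hK : IsOpen K) (hKD : K ⊆ D) {v : E d → E d}
    (hv : v ∈ H1 D) : wgrad K v =ᵐ[volume.restrict K] wgrad D v := by
  have h : ∀ i j : Fin d, ∀ᵐ x ∂(volume.restrict K), wgrad K v x i j = wgrad D v x i j :=
    fun i j => (weakPartial_spec ((H1_mono hKD hv).2 i j)).ae_unique hK
      ((weakPartial_spec (hv.2 i j)).mono hKD)
  filter_upwards [ae_all_iff.2 fun i => ae_all_iff.2 (h i)] with x hx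
  ext i j
  exact hx i j

/-! ### Matrix fields -/

lemma frob_self_nonneg {d : ℕ} (A : Matrix (Fin d) (Fin d) ℝ) : 0 ≤ frob A A :=
  Finset.sum_nonneg fun _ _ => Finset.sum_nonneg fun _ _ => mul_self_nonneg _

lemma frob_symmPart_le {d : ℕ} (A : Matrix (Fin d) (Fin d) ℝ) :
    frob ((1 / 2 : ℝ) • (A + A.transpose)) ((1 / 2 : ℝ) • (A + A.transpose)) ≤ frob A A := by
  have h : ∑ i, ∑ j, A j i * A j i = frob A A := Finset.sum_comm
  calc frob ((1 / 2 : ℝ) • (A + A.transpose)) ((1 / 2 : ℝ) • (A + A.transpose))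
      ≤ ∑ i, ∑ j, (1 / 2 * (A i j * A i j) + 1 / 2 * (A j i * A j i)) := by
        refine Finset.sum_le_sum fun i _ => Finset.sum_le_sum fun j _ => ?_
        simp only [Matrix.smul_apply, Matrix.add_apply, Matrix.transpose_apply, smul_eq_mul]
        nlinarith [sq_nonneg (A i j - A j i)]
    _ = 1 / 2 * frob A A + 1 / 2 * ∑ i, ∑ j, A j i * A j i := by
        simp only [Finset.sum_add_distrib, ← Finset.mul_sum, frob]
    _ = frob A A := by rw [h]; ring

lemma integrable_frob {d : ℕ} {D : Set (E d)} {A B : E d → Matrix (Fin d) (Fin d) ℝ}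
    (hA : ∀ i j, MemLp (fun x => A x i j) 2 (volume.restrict D))
    (hB : ∀ i j, MemLp (fun x => B x i j) 2 (volume.restrict D)) :
    Integrable (fun x => frob (A x) (B x)) (volume.restrict D) :=
  integrable_finsetSum _ fun i _ => integrable_finsetSum _ fun j _ =>
    (hA i j).integrable_mul (hB i j)

lemma integrable_inner_of_memLp {d : ℕ} {D : Set (E d)} {f v : E d → E d}
    (hf : MemLp f 2 (volume.restrict D)) (hv : MemLp v 2 (volume.restrict D)) :
    Integrable (fun x => inner ℝ (f x) (v x)) (volume.restrict D) := by
  have h : ∀ x, inner ℝ (f x) (v x) = ∑ i, v x i * f x i := fun x => by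
    simp [PiLp.inner_apply]
  simp only [h]
  exact integrable_finsetSum _ fun i _ => (memLp_coord hv i).integrable_mul (memLp_coord hf i)

lemma l2sq_nonneg {d : ℕ} (D : Set (E d)) (v : E d → E d) : 0 ≤ l2sq D v :=
  integral_nonneg fun _ => sq_nonneg _

lemma l2sqT_nonneg {d : ℕ} (D : Set (E d)) (A : E d → Matrix (Fin d) (Fin d) ℝ) :
    0 ≤ l2sqT D A :=
  integral_nonneg fun _ => frob_self_nonneg _

/-! ### Meshes -/

lemma IsMesh.isOpen {d : ℕ} {Ω : Set (E d)} {𝒯 : Finset (Set (E d))} (h : IsMesh Ω 𝒯)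
    {K : Set (E d)} (hK : K ∈ 𝒯) : IsOpen K := by
  obtain ⟨-, s, rfl⟩ := h.polytope K hK
  exact isOpen_interior

lemma IsMesh.volume_frontier {d : ℕ} {Ω : Set (E d)} {𝒯 : Finset (Set (E d))} (h : IsMesh Ω 𝒯)
    {K : Set (E d)} (hK : K ∈ 𝒯) : volume (frontier K) = 0 := by
  obtain ⟨-, s, rfl⟩ := h.polytope K hK
  exact (convex_convexHull ℝ _).interior.addHaar_frontier volume

lemma IsMesh.ae_eq_biUnion {d : ℕ} {Ω : Set (E d)} {𝒯 : Finset (Set (E d))} (h : IsMesh Ω 𝒯) :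
    Ω =ᵐ[volume] ⋃ K ∈ 𝒯, K := by
  refine (ae_le_set.2 ?_).antisymm (ae_le_set.2 ?_)
  · have hN : volume (⋃ K ∈ 𝒯, frontier K) = 0 :=
      (measure_biUnion_null_iff 𝒯.countable_toSet).2 fun K hK => h.volume_frontier hK
    refine measure_mono_null (fun x hx => ?_) hN
    have hx1 : x ∈ ⋃ K ∈ 𝒯, closure K := h.cover ▸ subset_closure hx.1
    simp only [mem_iUnion, exists_prop] at hx1 ⊢
    obtain ⟨K, hK, hxK⟩ := hx1
    exact ⟨K, hK, hxK, fun hxi => hx.2 (mem_biUnion hK (interior_subset hxi))⟩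
  · rw [sdiff_eq_empty.2 (iUnion₂_subset h.subset), measure_empty]

lemma IsMesh.integral_eq_sum {d : ℕ} {Ω : Set (E d)} {𝒯 : Finset (Set (E d))} (h : IsMesh Ω 𝒯)
    {f : E d → ℝ} (hf : Integrable f (volume.restrict Ω)) :
    ∫ x in Ω, f x = ∑ K ∈ 𝒯, ∫ x in K, f x := by
  rw [setIntegral_congr_set h.ae_eq_biUnion]
  exact integral_biUnion_finset 𝒯 (fun K hK => (h.isOpen hK).measurableSet)
    (fun K hK K' hK' hne => h.disjoint K hK K' hK' hne)
    (fun K hK => IntegrableOn.mono_set hf (h.subset K hK))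

/-! ### The broken norm -/

lemma IsMesh.l2sq_eq_sum {d : ℕ} {Ω : Set (E d)} {𝒯 : Finset (Set (E d))} (h : IsMesh Ω 𝒯)
    {v : E d → E d} (hv : MemLp v 2 (volume.restrict Ω)) :
    l2sq Ω v = ∑ K ∈ 𝒯, l2sq K v :=
  h.integral_eq_sum (hv.integrable_norm_pow two_ne_zero)

lemma IsMesh.sum_l2sqT_strain_le {d : ℕ} {Ω : Set (E d)} {𝒯 : Finset (Set (E d))}
    (h : IsMesh Ω 𝒯) {v : E d → E d} (hv : v ∈ H1 Ω) :
    ∑ K ∈ 𝒯, l2sqT K (strain K v) ≤ l2sqT Ω (wgrad Ω v) := by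
  have hi := integrable_frob (memLp_wgrad hv) (memLp_wgrad hv)
  rw [l2sqT, h.integral_eq_sum hi]
  refine Finset.sum_le_sum fun K hK => integral_mono_of_nonneg
    (Eventually.of_forall fun x => frob_self_nonneg _)
    (IntegrableOn.mono_set hi (h.subset K hK)) ?_
  filter_upwards [wgrad_ae_eq (h.isOpen hK) (h.subset K hK) hv] with x hx
  simp only [strain, hx]
  exact frob_symmPart_le _

lemma xnorm_le {d : ℕ} {Ω : Set (E d)} {𝒯 : Finset (Set (E d))} (h : IsMesh Ω 𝒯)
    {v : L2V Ω} (hv : ⇑v ∈ H1 Ω) :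
    xnorm 𝒯 v ≤ (1 + 1 / Metric.diam Ω) * h1norm Ω v := by
  have hρ : 0 ≤ 1 / Metric.diam Ω := one_div_nonneg.2 Metric.diam_nonneg
  refine Real.sqrt_le_iff.2 ⟨mul_nonneg (by linarith) (Real.sqrt_nonneg _), ?_⟩
  rw [mul_pow, h1norm, Real.sq_sqrt (add_nonneg (l2sq_nonneg _ _) (l2sqT_nonneg _ _)),
    Finset.sum_add_distrib, ← Finset.mul_sum, ← h.l2sq_eq_sum hv.1, ← one_div_pow, mul_add]
  refine add_le_add (mul_le_mul_of_nonneg_right ?_ (l2sq_nonneg _ _))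
    ((h.sum_l2sqT_strain_le hv).trans (le_mul_of_one_le_left (l2sqT_nonneg _ _) ?_)) <;>
  nlinarith

/-- The `L²` part of the broken norm is weighted by the inverse of the diameter, hence the
hypothesis that the diameter is positive. -/
lemma xnorm_pos {d : ℕ} {Ω : Set (E d)} {𝒯 : Finset (Set (E d))} (h : IsMesh Ω 𝒯)
    (hρ : 0 < Metric.diam Ω) {v : L2V Ω} (hv : v ≠ 0) : 0 < xnorm 𝒯 v := by
  have hL := Lp.memLp v
  have hpos : 0 < l2sq Ω v := by
    refine lt_of_le_of_ne (l2sq_nonneg _ _) fun h0 => hv ?_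
    have h1 := (integral_eq_zero_iff_of_nonneg (fun _ => sq_nonneg _)
      (hL.integrable_norm_pow two_ne_zero)).1 h0.symm
    refine (Lp.eq_zero_iff_ae_eq_zero).2 ?_
    filter_upwards [h1] with x hx
    simpa using hx
  refine Real.sqrt_pos.2 ?_
  rw [Finset.sum_add_distrib, ← Finset.mul_sum, ← h.l2sq_eq_sum hL]
  exact add_pos_of_pos_of_nonneg (by positivity)
    (Finset.sum_nonneg fun _ _ => l2sqT_nonneg _ _)

lemma IsPolyhedralDomain.diam_pos {d : ℕ} (hd : 0 < d) {Ω : Set (E d)}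
    (hΩ : IsPolyhedralDomain Ω) : 0 < Metric.diam Ω := by
  have := Fin.pos_iff_nonempty.1 hd
  have := hΩ.simplyConnected
  obtain ⟨x, hx⟩ := (inferInstance : Nonempty Ω)
  have hne : Ω.Nontrivial := by
    rw [← not_subsingleton_iff]
    intro hs
    have h1 : Ω = {x} := hs.eq_singleton_of_mem hx
    exact not_isOpen_singleton x (h1 ▸ hΩ.isOpen)
  exact Metric.diam_pos hne hΩ.bounded

/-! ### Conforming fields in the kernel of `b` -/

lemma IsBoundaryPartition.H10_le {d : ℕ} {Ω ΓD ΓN : Set (E d)}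
    (h : IsBoundaryPartition Ω ΓD ΓN) : H10 Ω ΓD ≤ H10 Ω (frontier Ω \ ΓN) := by
  rintro v ⟨g, hg, hg'⟩
  refine ⟨g, hg, ?_⟩
  have hN : ∀ᵐ x ∂((surf d).restrict (frontier Ω)), x ∉ frontier Ω \ (ΓD ∪ ΓN) :=
    ae_restrict_of_ae (measure_eq_zero_iff_ae_notMem.1 h.null)
  filter_upwards [hg', hN] with x h1 h2 hx
  exact h1 (by_contra fun hxD => h2 ⟨hx.1, fun hu => hu.elim hxD hx.2⟩)

lemma IsMesh.sum_normalPairing {d : ℕ} {Ω : Set (E d)} {𝒯 : Finset (Set (E d))}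
    (h : IsMesh Ω 𝒯) {τ : E d → Matrix (Fin d) (Fin d) ℝ} {f v : E d → E d}
    (hτ : HasDivSym Ω τ f) (hv : v ∈ H1 Ω) :
    ∑ K ∈ 𝒯, normalPairing K τ f v = normalPairing Ω τ f v := by
  rw [normalPairing, h.integral_eq_sum (integrable_inner_of_memLp hτ.memLp_div hv.1),
    h.integral_eq_sum (integrable_frob hτ.memLp (memLp_wgrad hv)), ← Finset.sum_add_distrib]
  refine Finset.sum_congr rfl fun K hK => ?_
  rw [normalPairing]
  congr 1
  refine integral_congr_ae ?_
  filter_upwards [wgrad_ae_eq (h.isOpen hK) (h.subset K hK) hv] with x hx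
  rw [hx]

lemma bForm_eq_zero {d : ℕ} {Ω ΓD ΓN : Set (E d)} {𝒯 : Finset (Set (E d))}
    (hΓ : IsBoundaryPartition Ω ΓD ΓN) (h : IsMesh Ω 𝒯) {v : L2V Ω} (hv : v ∈ H10Space Ω ΓD)
    {l : BoundaryFunctionals 𝒯} (hl : l ∈ MSpace Ω ΓN 𝒯) : bForm 𝒯 v l = 0 := by
  obtain ⟨τ, f, hτ, hl⟩ := hl
  have hv1 : ⇑v ∈ H1 Ω := H10_le_H1 _ _ hv
  have e : ∀ K : 𝒯, (l K : Module.Dual ℝ (HHalf (K : Set (E d)))) (traceOn (K : Set (E d)) v)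
      = normalPairing (K : Set (E d)) τ f v := fun K => by
    rw [traceOn, dif_pos (H1_mono (h.subset K K.2) hv1), hl]
  rw [bForm, Finset.sum_congr rfl fun K _ => e K,
    Finset.sum_coe_sort 𝒯 fun K => normalPairing K τ f v, h.sum_normalPairing hτ.1 hv1,
    hτ.2 v (hΓ.H10_le hv), neg_zero]

/-! ### Transfer of the inf-sup condition -/

lemma cForm_zero {d : ℕ} {Ω : Set (E d)} {𝒯 : Finset (Set (E d))} (h : IsMesh Ω 𝒯)
    (v : L2V Ω) : cForm 𝒯 v 0 = 0 := by
  refine Finset.sum_eq_zero fun K hK => integral_eq_zero_of_ae ?_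
  have h0 := Lp.coeFn_zero ℝ 2 (volume.restrict Ω)
  filter_upwards [ae_mono (Measure.restrict_mono (h.subset K hK) le_rfl) h0] with x hx
  rw [hx, Pi.zero_apply, mul_zero]

/-- If `V ⊆ W`, and on `V` the norm `m` is at most `C` times `n`, then an inf-sup condition over
`V` for `n` gives one over `W` for `m`, with the constant divided by `C`. -/
lemma InfSup.transfer {d : ℕ} {Ω : Set (E d)} {𝒯 : Finset (Set (E d))} (h : IsMesh Ω 𝒯)
    {V W : Set (L2V Ω)} {Q : Set (L2S Ω)} {n m : L2V Ω → ℝ} {β C : ℝ} (hβ : 0 < β) (hC : 0 < C)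
    (hVW : V ⊆ W) (hm : ∀ v ∈ V, v ≠ 0 → 0 < m v) (hle : ∀ v ∈ V, m v ≤ C * n v)
    (hV : InfSup 𝒯 V Q n β) : InfSup 𝒯 W Q m (β / C) := by
  intro q hq
  have hq' := hV q hq
  rcases eq_or_ne q 0 with rfl | hq0
  · -- Only the existence of a nonzero element is at stake: the empty supremum is `⊥`.
    rw [norm_zero, mul_zero] at hq' ⊢
    obtain ⟨v, hv⟩ := lt_iSup_iff.1 ((EReal.bot_lt_coe 0).trans_le hq')
    obtain ⟨⟨hvV, hv0⟩, -⟩ := lt_iSup_iff.1 hv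
    refine le_iSup₂_of_le v ⟨hVW hvV, hv0⟩ ?_
    rw [cForm_zero h, zero_div]
  · have hqn : 0 < ‖q‖ := norm_pos_iff.2 hq0
    refine EReal.ge_of_forall_gt_iff_ge.1 fun a ha => ?_
    -- Comparing with `max a 0` makes the numerators positive, so that they do not reverse the
    -- comparison of the two norms.
    have ha' : max a 0 < β / C * ‖q‖ := max_lt (EReal.coe_lt_coe_iff.1 ha) (by positivity)
    have haC : C * max a 0 < β * ‖q‖ := by
      calc C * max a 0 < C * (β / C * ‖q‖) := mul_lt_mul_of_pos_left ha' hC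
        _ = β * ‖q‖ := by field_simp
    obtain ⟨v, hv⟩ := lt_iSup_iff.1 ((EReal.coe_lt_coe_iff.2 haC).trans_le hq')
    obtain ⟨⟨hvV, hv0⟩, hv⟩ := lt_iSup_iff.1 hv
    refine le_iSup₂_of_le v ⟨hVW hvV, hv0⟩ (EReal.coe_le_coe_iff.2 ?_)
    have hmv := hm v hvV hv0
    have hnv : 0 < n v := pos_of_mul_pos_right (hmv.trans_le (hle v hvV)) hC.le
    refine (le_max_left a 0).trans ((le_div_iff₀ hmv).2 ?_)
    calc max a 0 * m v ≤ max a 0 * (C * n v) :=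
          mul_le_mul_of_nonneg_left (hle v hvV) (le_max_right _ _)
      _ = C * max a 0 * n v := by ring
      _ ≤ cForm 𝒯 v q := ((lt_div_iff₀ hnv).1 (EReal.coe_lt_coe_iff.1 hv)).le

end HDP

theorem mainTheorem8 (d : ℕ) (hd : d = 2 ∨ d = 3) (Ω ΓD : Set (HDP.E d))
    (hΩ : HDP.IsPolyhedralDomain Ω) :
    ∃ C : ℝ, 0 < C ∧
      ∀ (ΓN : Set (HDP.E d)), HDP.IsBoundaryPartition Ω ΓD ΓN →
      ∀ (𝒯 : Finset (Set (HDP.E d))), HDP.IsMesh Ω 𝒯 →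
        (∀ v ∈ HDP.H10Space Ω ΓD, HDP.xnorm 𝒯 v ≤ C * HDP.h1norm Ω v) ∧
        ∀ (Uh : Submodule ℝ (HDP.L2V Ω)) (Ph : Submodule ℝ (HDP.L2S Ω))
          (Mh : Submodule ℝ (HDP.BoundaryFunctionals 𝒯)),
          FiniteDimensional ℝ Uh → FiniteDimensional ℝ Ph → Module.Finite ℝ Mh →
          (Uh : Set (HDP.L2V Ω)) ⊆ HDP.H10Space Ω ΓD →
          (Ph : Set (HDP.L2S Ω)) ⊆ HDP.PSpace Ω ΓD →
          (Mh : Set (HDP.BoundaryFunctionals 𝒯)) ⊆ HDP.MSpace Ω ΓN 𝒯 →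
          ∀ βS : ℝ, 0 < βS →
            HDP.InfSup 𝒯 (Uh : Set (HDP.L2V Ω)) (Ph : Set (HDP.L2S Ω))
              (fun v => HDP.h1norm Ω v) βS →
            ∀ Xh : Submodule ℝ (HDP.L2V Ω), FiniteDimensional ℝ Xh →
              (Xh : Set (HDP.L2V Ω)) ⊆ HDP.XSpace Ω 𝒯 → Uh ≤ Xh →
              HDP.InfSup 𝒯 (HDP.kernelB 𝒯 Xh Mh) (Ph : Set (HDP.L2S Ω))
                (HDP.xnorm 𝒯) (βS / C) := by
  have hρ := hΩ.diam_pos (by omega)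
  have hC : 0 < 1 + 1 / Metric.diam Ω := by positivity
  refine ⟨_, hC, fun ΓN hΓ 𝒯 h𝒯 => ?_⟩
  have hle : ∀ v ∈ HDP.H10Space Ω ΓD,
      HDP.xnorm 𝒯 v ≤ (1 + 1 / Metric.diam Ω) * HDP.h1norm Ω v :=
    fun v hv => HDP.xnorm_le h𝒯 (HDP.H10_le_H1 _ _ hv)
  refine ⟨hle, fun Uh Ph Mh _ _ _ hU _ hM βS hβ hS Xh _ _ hUX => ?_⟩
  exact hS.transfer h𝒯 hβ hC
    (fun v hv => ⟨hUX hv, fun l hl => HDP.bForm_eq_zero hΓ h𝒯 (hU hv) (hM hl)⟩)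
    (fun v _ hv0 => HDP.xnorm_pos h𝒯 hρ hv0) (fun v hv => hle v (hU hv))
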